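/- Let $p$ be a prime, let $\mathbb{Z}_p$ be the ring of $p$-adic integers with field of fractions $\mathbb{Q}_p$, and let $n \geq 2$ be an integer. For $\mathbf{a} = (a_0,\dots,a_n) \in \mathbb{Z}_p^{n+1}$ let $X_{\mathbf{a}}^{2} \subset \mathbb{P}^n$ be the diagonal quadric over $\mathbb{Q}_p$ defined by $\sum_{i=0}^{n} a_i x_i^2 = 0$. Put \[ \rho_p(n,2) := \mu_p\left(\left\{\mathbf{a} \in \mathbb{Z}_p^{n+1} \;:\; X_{\mathbf{a}}^{2}(\mathbb{Q}_p) \neq \emptyset\right\}\right), \] where $\mu_p$ is the product measure on $\mathbb{Z}_p^{n+1}$ of the Haar measure on $\mathbb{Z}_p$ normalized to have total mass $1$. Then the following hold. 1. If $n = 2$, then $\rho_2(2,2) = \dfrac{7}{12}$, and for every odd prime $p$, \[ \rho_p(2,2) = 1 - \frac{3}{2}\,p^{-1}\left(\frac{1-p^{-1}}{1-p^{-2}}\right)^{2}. \] 2. If $n = 3$, then $\rho_2(3,2) = \dfrac{1231}{1296}$, and for every odd prime $p$, \[ \rho_p(3,2) = 1 - \frac{3}{2}\,p^{-2}\left(\frac{1-p^{-1}}{1-p^{-2}}\right)^{4}.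 \] 3. If $n \geq 4$, then $\rho_p(n,2) = 1$ for every prime $p$. -/

import Mathlib

open MeasureTheory

open scoped LinearAlgebra.Projectivization

noncomputable section

/-- The set `X_a^k(K)` of `K`-rational points of the diagonal hypersurface
`∑ i, a i * x i ^ k = 0` in the projective space `ℙ^n` over the field `K`.
(Independence of the chosen representative of a point: `mk_mem_diagonalHypersurface`.) -/
def diagonalHypersurface {K : Type*} [Field K] {n : ℕ} (k : ℕ) (a : Fin (n + 1) → K) :
    Set (ℙ K (Fin (n + 1) → K)) :=
  {P | ∑ i, a i * P.rep i ^ k = 0}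

theorem mk_mem_diagonalHypersurface {K : Type*} [Field K] {n : ℕ} (k : ℕ)
    (a : Fin (n + 1) → K) (x : Fin (n + 1) → K) (hx : x ≠ 0) :
    Projectivization.mk K x hx ∈ diagonalHypersurface k a ↔ ∑ i, a i * x i ^ k = 0 := by
  obtain ⟨c, hc⟩ := Projectivization.exists_smul_eq_mk_rep K x hx
  have h : ∑ i, a i * (Projectivization.mk K x hx).rep i ^ k
      = (c : K) ^ k * ∑ i, a i * x i ^ k := by
    rw [← hc, Finset.mul_sum]
    refine Finset.sum_congr rfl fun i _ => ?_
    simp only [Pi.smul_apply, Units.smul_def, smul_eq_mul, mul_pow]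
    ring
  simp [diagonalHypersurface, h]

theorem diagonalHypersurface_nonempty_iff {K : Type*} [Field K] {n : ℕ} (k : ℕ)
    (a : Fin (n + 1) → K) :
    (diagonalHypersurface k a).Nonempty ↔
      ∃ x : Fin (n + 1) → K, x ≠ 0 ∧ ∑ i, a i * x i ^ k = 0 := by
  constructor
  · rintro ⟨P, hP⟩
    exact ⟨P.rep, P.rep_nonzero, hP⟩
  · rintro ⟨x, hx, h⟩
    exact ⟨_, (mk_mem_diagonalHypersurface k a x hx).2 h⟩

/-- `ℤ_p` carries its Borel σ-algebra. -/
instance instMeasurableSpacePadicInt (p : ℕ) [Fact p.Prime] : MeasurableSpace ℤ_[p] :=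
  borel ℤ_[p]

instance instBorelSpacePadicInt (p : ℕ) [Fact p.Prime] : BorelSpace ℤ_[p] := ⟨rfl⟩

/-- The Haar measure `μ_p` on `ℤ_p`, normalized by `μ_p(ℤ_p) = 1`. -/
def padicHaar (p : ℕ) [Fact p.Prime] : Measure ℤ_[p] :=
  Measure.addHaarMeasure ⊤

instance instIsAddHaarMeasurePadicHaar (p : ℕ) [Fact p.Prime] :
    (padicHaar p).IsAddHaarMeasure :=
  inferInstanceAs (Measure.addHaarMeasure ⊤).IsAddHaarMeasure

instance instIsProbabilityMeasurePadicHaar (p : ℕ) [Fact p.Prime] :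
    IsProbabilityMeasure (padicHaar p) :=
  ⟨by simpa [padicHaar] using
    Measure.addHaarMeasure_self (K₀ := (⊤ : TopologicalSpace.PositiveCompacts ℤ_[p]))⟩

/-- The set of `a ∈ ℤ_p^{n+1}` such that `X_a^k(ℚ_p)` is nonempty. -/
def solubleSet (p : ℕ) [Fact p.Prime] (n k : ℕ) : Set (Fin (n + 1) → ℤ_[p]) :=
  {a | (diagonalHypersurface k (fun i => (a i : ℚ_[p]))).Nonempty}

/-- The local density `ρ_p(n, k)`: the measure of `solubleSet p n k` for the product measure
of the normalized Haar measure on the `n + 1` factors `ℤ_p`.  The set is closed, hence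
measurable (`isClosed_solubleSet`), and the product measure has total mass one. -/
def localDensity (p : ℕ) [Fact p.Prime] (n k : ℕ) : ℝ :=
  (Measure.pi fun _ : Fin (n + 1) => padicHaar p).real (solubleSet p n k)

end

theorem padicInt_coe_sum_mul_pow (p : ℕ) [Fact p.Prime] (n k : ℕ) (a x : Fin (n + 1) → ℤ_[p]) :
    ((∑ i, a i * x i ^ k : ℤ_[p]) : ℚ_[p]) = ∑ i, (a i : ℚ_[p]) * (x i : ℚ_[p]) ^ k := by
  simp [PadicInt.coe_sum]

theorem mem_solubleSet_iff (p : ℕ) [Fact p.Prime] (n k : ℕ) (a : Fin (n + 1) → ℤ_[p]) :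
    a ∈ solubleSet p n k ↔
      ∃ x : Fin (n + 1) → ℤ_[p], ‖x‖ = 1 ∧ ∑ i, a i * x i ^ k = 0 := by
  unfold solubleSet
  change (diagonalHypersurface k (fun i => (a i : ℚ_[p]))).Nonempty ↔ _
  rw [diagonalHypersurface_nonempty_iff]
  constructor
  · rintro ⟨x, hx, h⟩
    obtain ⟨j, -, hj⟩ := Finset.exists_max_image Finset.univ (fun i => ‖x i‖)
      ⟨0, Finset.mem_univ _⟩
    have hj0 : x j ≠ 0 := by
      intro h0
      apply hx
      funext i
      have := hj i (Finset.mem_univ i)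
      simpa [h0] using this
    have hpos : 0 < ‖x j‖ := norm_pos_iff.2 hj0
    have hle : ∀ i, ‖x i / x j‖ ≤ 1 := fun i => by
      rw [norm_div, div_le_one hpos]
      exact hj i (Finset.mem_univ i)
    let y : Fin (n + 1) → ℤ_[p] := fun i => ⟨x i / x j, hle i⟩
    have hy : ∀ i, (y i : ℚ_[p]) = x i / x j := fun i => rfl
    refine ⟨y, le_antisymm ?_ ?_, ?_⟩
    · exact (pi_norm_le_iff_of_nonneg zero_le_one).2 fun i => (y i).2
    · have h2 : ‖y j‖ = 1 := by
        rw [PadicInt.norm_def, hy, div_self hj0, norm_one]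
      rw [← h2]
      exact norm_le_pi_norm y j
    · apply PadicInt.ext
      have : ∑ i, (a i : ℚ_[p]) * (y i : ℚ_[p]) ^ k
          = (∑ i, (a i : ℚ_[p]) * x i ^ k) / x j ^ k := by
        rw [Finset.sum_div]
        exact Finset.sum_congr rfl fun i _ => by rw [hy, div_pow, mul_div_assoc]
      rw [padicInt_coe_sum_mul_pow, this, h, zero_div, PadicInt.coe_zero]
  · rintro ⟨x, hx, h⟩
    refine ⟨fun i => (x i : ℚ_[p]), ?_, ?_⟩
    · intro h0
      have : x = 0 := by
        funext i
        exact PadicInt.ext (by simpa using congrFun h0 i)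
      simp [this] at hx
    · change ∑ i, (a i : ℚ_[p]) * (x i : ℚ_[p]) ^ k = 0
      rw [← padicInt_coe_sum_mul_pow, h, PadicInt.coe_zero]

theorem isClosed_solubleSet (p : ℕ) [Fact p.Prime] (n k : ℕ) : IsClosed (solubleSet p n k) := by
  have hS : IsClosed {q : (Fin (n + 1) → ℤ_[p]) × (Fin (n + 1) → ℤ_[p]) |
      ‖q.2‖ = 1 ∧ ∑ i, q.1 i * q.2 i ^ k = 0} :=
    (isClosed_eq (by fun_prop) continuous_const).inter
      (isClosed_eq (by fun_prop) continuous_const)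
  have h := isClosedMap_fst_of_compactSpace _ hS
  convert h using 1
  ext a
  rw [mem_solubleSet_iff]
  simp

/-! Rescaling variables shows that solubility of a diagonal quadratic form depends only on the
square classes of its coefficients. For odd `p`, a nonzero `a` has its square class given by the
parity `e` of its valuation and the quadratic character of its unit part; for `p = 2`, by `e` and
the unit part modulo `8`. A class with unit part in `B` has measure `p⁻ᵉ μ(B) / (1 - p⁻²)`
(`padicHaar_real_parityClass`), and zero coefficients form a null set, so the density is a finite
sum over tuples of soluble classes (`localDensity_eq_sum_classes`).

It remains to decide which tuples are soluble. For odd `p`, split the form as `f₀ + p f₁` with unit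
coefficients in both blocks: by Springer's argument it is isotropic iff `f₀` or `f₁` is isotropic
modulo `p` (`mem_solubleSet_iff_isotropicClasses`), which is automatic for a block of three
variables. For `p = 2`, Hensel's lemma reduces solubility to a primitive zero modulo `16`
(`mem_solubleSet_iff_hasZeroModSixteen`). Both criteria are decidable, and the tuples are counted by
evaluation. With five variables, three coefficients share a parity; this settles odd `p`, and leaves
a finite check for `p = 2`. -/

/-! ### Haar measure of residue classes and of multiples. -/

theorem PadicInt.measurableEmbedding_mul_left {p : ℕ} [Fact p.Prime] {a : ℤ_[p]} (ha : a ≠ 0) :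
    MeasurableEmbedding (fun x : ℤ_[p] => a * x) :=
  (Continuous.isClosedEmbedding (by fun_prop)
    (mul_right_injective₀ ha)).measurableEmbedding

/-- Multiplication by a nonzero `a` scales the Haar measure of `ℤ_p` by a constant factor. -/
theorem padicHaar_real_image_mul_left {p : ℕ} [Fact p.Prime] {a : ℤ_[p]} (ha : a ≠ 0)
    (S : Set ℤ_[p]) :
    (padicHaar p).real ((fun x => a * x) '' S) =
      (padicHaar p).real ((fun x => a * x) '' Set.univ) * (padicHaar p).real S := by
  have hemb := PadicInt.measurableEmbedding_mul_left ha
  -- The pullback of Haar measure along `x ↦ a * x` is again translation invariant, hence a multiple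
  -- of Haar measure; evaluating at `Set.univ` identifies the factor.
  set ν := (padicHaar p).comap (fun x : ℤ_[p] => a * x) with hν
  have hinv : ν.IsAddLeftInvariant := by
    refine ⟨fun g => ?_⟩
    ext T hT
    rw [Measure.map_apply (measurable_const_add g) hT, hν, hemb.comap_apply, hemb.comap_apply]
    have : (fun x => a * x) '' ((fun x => g + x) ⁻¹' T)
        = (fun x => a * g + x) ⁻¹' ((fun x => a * x) '' T) := by
      ext y
      constructor
      · rintro ⟨x, hx, rfl⟩
        exact ⟨g + x, hx, mul_add a g x⟩
      · rintro ⟨t, ht, hty⟩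
        refine ⟨t - g, by simpa using ht, ?_⟩
        simp only at hty ⊢
        rw [mul_sub, hty]
        ring
    rw [this, measure_preimage_add]
  have hfin : IsFiniteMeasure ν := by
    refine ⟨?_⟩
    rw [hν, hemb.comap_apply]
    exact measure_lt_top _ _
  have h := Measure.isAddInvariant_eq_smul_of_compactSpace ν (padicHaar p)
  have key : ∀ T : Set ℤ_[p], (padicHaar p).real ((fun x => a * x) '' T)
      = (Measure.addHaarScalarFactor ν (padicHaar p) : ℝ) * (padicHaar p).real T := by
    intro T
    have : ν.real T = (padicHaar p).real ((fun x => a * x) '' T) := by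
      rw [measureReal_def, measureReal_def, hν, hemb.comap_apply]
    rw [← this, measureReal_def]
    conv_lhs => rw [h]
    simp [measureReal_def]
  rw [key S, key Set.univ]
  simp

/-- A residue class of `ℤ_p` modulo an ideal with quotient `ℤ / N` has measure `1 / N`. -/
theorem padicHaar_real_fiber {p N : ℕ} [Fact p.Prime] [NeZero N] (φ : ℤ_[p] →+* ZMod N)
    {a : ℤ_[p]} (ha : a ≠ 0) (hφ : RingHom.ker φ = Ideal.span {a}) (i : ZMod N) :
    MeasurableSet (φ ⁻¹' {i}) ∧ (padicHaar p).real (φ ⁻¹' {i}) = (N : ℝ)⁻¹ := by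
  have h0 : φ ⁻¹' {0} = (fun x => a * x) '' Set.univ := by
    ext x
    rw [Set.mem_preimage, Set.mem_singleton_iff, ← RingHom.mem_ker, hφ, Ideal.mem_span_singleton]
    simp [Dvd.dvd, eq_comm]
  have hm0 : MeasurableSet (φ ⁻¹' {0}) := by
    rw [h0]
    exact (PadicInt.measurableEmbedding_mul_left ha).measurableSet_image.2 MeasurableSet.univ
  -- All `N` fibres are translates of the kernel, so they share the total mass equally.
  have htrans : ∀ i : ZMod N, ∃ g : ℤ_[p], φ ⁻¹' {i} = (fun x => g + x) ⁻¹' (φ ⁻¹' {0}) := by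
    intro i
    obtain ⟨g, hg⟩ := ZMod.ringHom_surjective φ i
    refine ⟨-g, ?_⟩
    ext x
    simp [hg, neg_add_eq_zero, eq_comm (a := i)]
  have hm : ∀ i : ZMod N, MeasurableSet (φ ⁻¹' {i}) := by
    intro i
    obtain ⟨g, hg⟩ := htrans i
    rw [hg]
    exact measurable_const_add g hm0
  have hμ : ∀ i : ZMod N, (padicHaar p).real (φ ⁻¹' {i}) = (padicHaar p).real (φ ⁻¹' {0}) := by
    intro i
    obtain ⟨g, hg⟩ := htrans i
    rw [hg, measureReal_def, measureReal_def, measure_preimage_add]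
  refine ⟨hm i, ?_⟩
  have hsum : (padicHaar p).real (⋃ i ∈ (Finset.univ : Finset (ZMod N)), φ ⁻¹' {i})
      = ∑ i : ZMod N, (padicHaar p).real (φ ⁻¹' {i}) := by
    refine measureReal_biUnion_finset ?_ fun i _ => hm i
    intro i _ j _ hij
    exact Disjoint.preimage _ (by simpa using hij)
  have huniv : (⋃ i ∈ (Finset.univ : Finset (ZMod N)), φ ⁻¹' {i}) = Set.univ := by
    ext x; simp
  rw [huniv, Finset.sum_congr rfl fun i _ => hμ i] at hsum
  simp only [probReal_univ, Finset.sum_const, Finset.card_univ, ZMod.card, nsmul_eq_mul] at hsum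
  rw [hμ i]
  exact eq_inv_of_mul_eq_one_right hsum.symm

theorem padicHaar_real_preimage {p N : ℕ} [Fact p.Prime] [NeZero N] (φ : ℤ_[p] →+* ZMod N)
    {a : ℤ_[p]} (ha : a ≠ 0) (hφ : RingHom.ker φ = Ideal.span {a}) (T : Finset (ZMod N)) :
    MeasurableSet (φ ⁻¹' T) ∧ (padicHaar p).real (φ ⁻¹' T) = T.card * (N : ℝ)⁻¹ := by
  have hT : φ ⁻¹' (T : Set (ZMod N)) = ⋃ i ∈ T, φ ⁻¹' {i} := by
    ext x; simp
  rw [hT]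
  refine ⟨Finset.measurableSet_biUnion _ fun i _ => (padicHaar_real_fiber φ ha hφ i).1, ?_⟩
  rw [measureReal_biUnion_finset,
    Finset.sum_congr rfl fun i _ => (padicHaar_real_fiber φ ha hφ i).2]
  · simp
  · intro i _ j _ hij
    exact Disjoint.preimage _ (by simpa using hij)
  · exact fun i _ => (padicHaar_real_fiber φ ha hφ i).1

theorem padicHaar_real_image_p_mul {p : ℕ} [Fact p.Prime] (S : Set ℤ_[p]) :
    (padicHaar p).real ((fun x => (p : ℤ_[p]) * x) '' S)
      = (p : ℝ)⁻¹ * (padicHaar p).real S := by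
  have hp : (p : ℤ_[p]) ≠ 0 := PadicInt.prime_p.ne_zero
  have hker : RingHom.ker (PadicInt.toZMod (p := p)) = Ideal.span {(p : ℤ_[p])} := by
    rw [PadicInt.ker_toZMod, PadicInt.maximalIdeal_eq_span_p]
  have : NeZero p := ⟨(Fact.out : p.Prime).ne_zero⟩
  rw [padicHaar_real_image_mul_left hp, ← (padicHaar_real_fiber _ hp hker 0).2]
  congr 2
  ext x
  rw [Set.mem_preimage, Set.mem_singleton_iff, ← RingHom.mem_ker, hker, Ideal.mem_span_singleton]
  simp [Dvd.dvd, eq_comm]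

/-- Multiplication by `p` fixes `{0}` but divides its measure by `p`. -/
theorem padicHaar_singleton_zero (p : ℕ) [Fact p.Prime] : padicHaar p {0} = 0 := by
  have h := padicHaar_real_image_p_mul (p := p) {0}
  have hp : (1 : ℝ) < p := by exact_mod_cast (Fact.out : p.Prime).one_lt
  rw [Set.image_singleton, mul_zero] at h
  have hinv : (p : ℝ)⁻¹ < 1 := inv_lt_one_of_one_lt₀ hp
  have h' : (padicHaar p).real {0} = 0 := by
    by_contra hne
    have : (p : ℝ)⁻¹ = 1 := mul_right_cancel₀ hne (by rw [← h, one_mul])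
    linarith
  exact (measureReal_eq_zero_iff).1 h'

/-! ### Classes by parity of valuation and unit part. -/

/-- The `p`-adic integers of the form `p ^ (2 * k + e) * u` with `u ∈ B`. -/
def parityClass (p : ℕ) [Fact p.Prime] (e : Bool) (B : Set ℤ_[p]) : Set ℤ_[p] :=
  ⋃ k : ℕ, (fun x => (p : ℤ_[p]) ^ (2 * k + e.toNat) * x) '' B

theorem mem_parityClass {p : ℕ} [Fact p.Prime] {e : Bool} {B : Set ℤ_[p]} {a : ℤ_[p]} :
    a ∈ parityClass p e B ↔ ∃ k : ℕ, ∃ u ∈ B, (p : ℤ_[p]) ^ (2 * k + e.toNat) * u = a := by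
  simp [parityClass]

theorem measurableSet_parityClass {p : ℕ} [Fact p.Prime] (e : Bool) {B : Set ℤ_[p]}
    (hB : MeasurableSet B) : MeasurableSet (parityClass p e B) :=
  MeasurableSet.iUnion fun _ => (PadicInt.measurableEmbedding_mul_left
    (pow_ne_zero _ PadicInt.prime_p.ne_zero)).measurableSet_image.2 hB

theorem PadicInt.pow_mul_unit_inj {p : ℕ} [Fact p.Prime] {m n : ℕ} {u v : ℤ_[p]}
    (hu : IsUnit u) (hv : IsUnit v) (h : (p : ℤ_[p]) ^ m * u = (p : ℤ_[p]) ^ n * v) :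
    m = n ∧ u = v := by
  have hm : m = n := by
    have h' := congrArg PadicInt.valuation h
    rw [PadicInt.valuation_p_pow_mul _ _ hu.ne_zero, PadicInt.valuation_p_pow_mul _ _ hv.ne_zero]
      at h'
    have hval : ∀ w : ℤ_[p], IsUnit w → w.valuation = 0 := by
      intro w hw
      have h1 := PadicInt.norm_eq_zpow_neg_valuation hw.ne_zero
      rw [PadicInt.isUnit_iff.1 hw] at h1
      have hp : (1 : ℝ) < p := by exact_mod_cast (Fact.out : p.Prime).one_lt
      have := (zpow_eq_one_iff_right₀ (by linarith) hp.ne').1 h1.symm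
      omega
    rw [hval u hu, hval v hv] at h'
    omega
  subst hm
  exact ⟨rfl, mul_left_cancel₀ (pow_ne_zero _ PadicInt.prime_p.ne_zero) h⟩

/-- For even parity the class `E` is self-similar: `E = B ⊔ p² E`, disjoint because `B` consists of
units. Hence `μ(E) = μ(B) + p⁻² μ(E)`, with no series to sum. The odd class is `p E`. -/
theorem padicHaar_real_parityClass {p : ℕ} [Fact p.Prime] (e : Bool) {B : Set ℤ_[p]}
    (hB : MeasurableSet B) (hu : ∀ u ∈ B, IsUnit u) :
    (padicHaar p).real (parityClass p e B)
      = (p : ℝ)⁻¹ ^ e.toNat * ((padicHaar p).real B / (1 - ((p : ℝ) ^ 2)⁻¹)) := by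
  have hp : (1 : ℝ) < p := by exact_mod_cast (Fact.out : p.Prime).one_lt
  have hp2 : ((p : ℝ) ^ 2)⁻¹ < 1 := inv_lt_one_of_one_lt₀ (by nlinarith)
  have heven : (padicHaar p).real (parityClass p false B)
      = (padicHaar p).real B / (1 - ((p : ℝ) ^ 2)⁻¹) := by
    have hdec : parityClass p false B = B ∪
        (fun x => (p : ℤ_[p]) * x) '' ((fun x => (p : ℤ_[p]) * x) '' parityClass p false B) := by
      ext a
      simp only [Set.mem_union, Set.mem_image, mem_parityClass, Bool.toNat_false, add_zero]
      constructor
      · rintro ⟨k, u, hu, rfl⟩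
        rcases k with _ | k
        · left; simpa using hu
        · right
          exact ⟨_, ⟨_, ⟨k, u, hu, rfl⟩, rfl⟩, by ring⟩
      · rintro (ha | ⟨_, ⟨_, ⟨k, u, hu, rfl⟩, rfl⟩, rfl⟩)
        · exact ⟨0, a, ha, by simp⟩
        · exact ⟨k + 1, u, hu, by ring⟩
    have hdisj : Disjoint B ((fun x => (p : ℤ_[p]) * x) ''
        ((fun x => (p : ℤ_[p]) * x) '' parityClass p false B)) := by
      rw [Set.disjoint_left]
      rintro a ha ⟨b, -, rfl⟩
      exact PadicInt.prime_p.not_isUnit (isUnit_of_mul_isUnit_left (hu _ ha))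
    have hE := PadicInt.measurableEmbedding_mul_left (p := p) PadicInt.prime_p.ne_zero
    have h := congrArg (padicHaar p).real hdec
    rw [measureReal_union hdisj (hE.measurableSet_image.2 (hE.measurableSet_image.2
      (measurableSet_parityClass _ hB))), padicHaar_real_image_p_mul,
      padicHaar_real_image_p_mul] at h
    rw [eq_div_iff (by linarith), ← inv_pow]
    linear_combination h
  cases e
  · simpa using heven
  · have : parityClass p true B = (fun x => (p : ℤ_[p]) * x) '' parityClass p false B := by
      ext a
      simp only [Set.mem_image, mem_parityClass, Bool.toNat_false, add_zero, Bool.toNat_true]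
      constructor
      · rintro ⟨k, u, hu, rfl⟩
        exact ⟨_, ⟨k, u, hu, rfl⟩, by ring⟩
      · rintro ⟨_, ⟨k, u, hu, rfl⟩, rfl⟩
        exact ⟨k, u, hu, by ring⟩
    rw [this, padicHaar_real_image_p_mul, heven]
    simp

theorem PadicInt.exists_mem_parityClass {p : ℕ} [Fact p.Prime] {a : ℤ_[p]} (ha : a ≠ 0) :
    ∃ e : Bool, ∃ k : ℕ, ∃ u : ℤ_[p], IsUnit u ∧ (p : ℤ_[p]) ^ (2 * k + e.toNat) * u = a := by
  refine ⟨decide (a.valuation % 2 = 1), a.valuation / 2, PadicInt.unitCoeff ha,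
    (PadicInt.unitCoeff ha).isUnit, ?_⟩
  have : 2 * (a.valuation / 2) + (decide (a.valuation % 2 = 1)).toNat = a.valuation := by
    rcases Nat.mod_two_eq_zero_or_one a.valuation with h | h <;> simp [h] <;> omega
  rw [this, mul_comm]
  exact (PadicInt.unitCoeff_spec ha).symm

theorem disjoint_parityClass {p : ℕ} [Fact p.Prime] {e e' : Bool} {B B' : Set ℤ_[p]}
    (hB : ∀ u ∈ B, IsUnit u) (hB' : ∀ u ∈ B', IsUnit u) (h : e ≠ e' ∨ Disjoint B B') :
    Disjoint (parityClass p e B) (parityClass p e' B') := by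
  rw [Set.disjoint_left]
  intro a ha ha'
  obtain ⟨k, u, hu, rfl⟩ := mem_parityClass.1 ha
  obtain ⟨k', u', hu', hh⟩ := mem_parityClass.1 ha'
  obtain ⟨h1, h2⟩ := PadicInt.pow_mul_unit_inj (hB' _ hu') (hB _ hu) hh
  rcases h with h | h
  · cases e <;> cases e' <;> simp_all <;> omega
  · exact Set.disjoint_left.1 h hu (h2 ▸ hu')

/-- If membership in `S` is determined almost everywhere by the classes of the coordinates, then
the measure of `S` is a finite sum over tuples of classes. -/
theorem measureReal_pi_eq_sum_classes {α C : Type*} [MeasurableSpace α] [Fintype C] {n : ℕ}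
    (μ : Measure α) [IsProbabilityMeasure μ] (A : C → Set α) (hA : ∀ c, MeasurableSet (A c))
    (hdisj : ∀ c d, c ≠ d → Disjoint (A c) (A d)) (hcover : ∀ᵐ x ∂μ, ∃ c, x ∈ A c)
    (S : Set (Fin n → α)) (P : (Fin n → C) → Prop) [DecidablePred P]
    (hS : ∀ a c, (∀ i, a i ∈ A (c i)) → (a ∈ S ↔ P c)) :
    (Measure.pi fun _ : Fin n => μ).real S
      = ∑ c : Fin n → C with P c, ∏ i, μ.real (A (c i)) := by
  classical
  have hae : ∀ᵐ a ∂(Measure.pi fun _ : Fin n => μ), ∀ i, ∃ c, a i ∈ A c := by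
    rw [ae_all_iff]
    intro i
    exact (Measure.tendsto_eval_ae_ae (μ := fun _ : Fin n => μ) (i := i)).eventually hcover
  -- Up to a null set `S` is a finite disjoint union of boxes, so no measurability of `S` is
  -- required.
  have hSeq : S =ᵐ[Measure.pi fun _ : Fin n => μ]
      (⋃ c ∈ (Finset.univ.filter P : Finset (Fin n → C)), Set.univ.pi fun i => A (c i) : Set _) := by
    filter_upwards [hae] with a ha
    choose c hc using ha
    apply propext
    change a ∈ S ↔ a ∈ ⋃ c ∈ (Finset.univ.filter P : Finset (Fin n → C)),
      Set.univ.pi fun i => A (c i)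
    rw [hS a c hc]
    simp only [Finset.mem_filter, Finset.mem_univ, true_and, Set.mem_iUnion, Set.mem_pi]
    constructor
    · exact fun h => ⟨c, h, fun i _ => hc i⟩
    · rintro ⟨d, hd, had⟩
      have : c = d := by
        funext i
        by_contra hne
        exact Set.disjoint_left.1 (hdisj _ _ hne) (hc i) (had i trivial)
      exact this ▸ hd
  rw [measureReal_congr hSeq, measureReal_biUnion_finset]
  · refine Finset.sum_congr rfl fun c _ => ?_
    simp [measureReal_def, Measure.pi_pi, ENNReal.toReal_prod]
  · intro c _ d _ hcd
    obtain ⟨i, hi⟩ := Function.ne_iff.1 hcd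
    refine Set.disjoint_left.2 fun a ha ha' => ?_
    exact Set.disjoint_left.1 (hdisj _ _ hi) (ha i trivial) (ha' i trivial)
  · exact fun c _ => MeasurableSet.univ_pi fun i => hA _

/-! ### Squares in `ℤ_p` by Hensel's lemma. -/

theorem PadicInt.exists_sq_eq_of_norm_lt {p : ℕ} [Fact p.Prime] {a z : ℤ_[p]}
    (h : ‖a ^ 2 - z‖ < ‖2 * a‖ ^ 2) : ∃ w, w ^ 2 = z := by
  have hF : Polynomial.derivative (Polynomial.X ^ 2 - Polynomial.C z : Polynomial ℤ_[p])
      = Polynomial.C 2 * Polynomial.X := by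
    simp [one_add_one_eq_two]
  obtain ⟨w, hw, -⟩ := hensels_lemma (F := (Polynomial.X ^ 2 - Polynomial.C z : Polynomial ℤ_[p]))
    (a := a) (by rw [hF]; simpa using h)
  exact ⟨w, by simpa [sub_eq_zero] using hw⟩

theorem PadicInt.isUnit_iff_toZMod_ne_zero {p : ℕ} [Fact p.Prime] {x : ℤ_[p]} :
    IsUnit x ↔ PadicInt.toZMod x ≠ 0 := by
  rw [Ne, ← RingHom.mem_ker, PadicInt.ker_toZMod, IsLocalRing.mem_maximalIdeal, mem_nonunits_iff,
    not_not]

theorem PadicInt.toZMod_eq_zero_iff_dvd {p : ℕ} [Fact p.Prime] {x : ℤ_[p]} :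
    PadicInt.toZMod x = 0 ↔ (p : ℤ_[p]) ∣ x := by
  rw [← RingHom.mem_ker, PadicInt.ker_toZMod, PadicInt.maximalIdeal_eq_span_p,
    Ideal.mem_span_singleton]

theorem PadicInt.norm_two_of_ne_two {p : ℕ} [Fact p.Prime] (hp : p ≠ 2) : ‖(2 : ℤ_[p])‖ = 1 := by
  have h : (2 : ℤ_[p]) = ((2 : ℕ) : ℤ_[p]) := by norm_cast
  rw [h, PadicInt.norm_natCast_eq_one_iff]
  exact (Nat.coprime_primes Fact.out Nat.prime_two).2 hp

/-- For odd `p`, a unit of `ℤ_p` that is a square modulo `p` is a square. -/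
theorem PadicInt.exists_sq_eq_of_isSquare_toZMod {p : ℕ} [Fact p.Prime] (hp : p ≠ 2) {z : ℤ_[p]}
    (hz : IsUnit z) (h : IsSquare (PadicInt.toZMod z)) : ∃ w, w ^ 2 = z := by
  obtain ⟨b, hb⟩ := h
  obtain ⟨a, rfl⟩ := ZMod.ringHom_surjective (PadicInt.toZMod (p := p)) b
  have ha : IsUnit a := by
    rw [PadicInt.isUnit_iff_toZMod_ne_zero] at hz ⊢
    intro h0
    simp [hb, h0] at hz
  refine PadicInt.exists_sq_eq_of_norm_lt (a := a) ?_
  rw [norm_mul, PadicInt.norm_two_of_ne_two hp, PadicInt.isUnit_iff.1 ha, mul_one, one_pow,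
    PadicInt.norm_lt_one_iff_dvd, ← PadicInt.toZMod_eq_zero_iff_dvd, map_sub, map_pow, hb]
  ring

/-- An element of `ℤ_2` congruent to `1` modulo `8` is the square of a unit. -/
theorem PadicInt.exists_isUnit_sq_eq_of_dvd {z : ℤ_[2]} (h : 8 ∣ z - 1) :
    ∃ w, IsUnit w ∧ w ^ 2 = z := by
  have h2 : ‖(2 : ℤ_[2])‖ = 2⁻¹ := by simpa using PadicInt.norm_p (p := 2)
  obtain ⟨t, ht⟩ := h
  -- Hensel's lemma starts at `1`: the error is at most `1/8`, below `‖2‖ ^ 2 = 1/4`.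
  have hn : ‖(1 : ℤ_[2]) ^ 2 - z‖ < ‖2 * (1 : ℤ_[2])‖ ^ 2 := by
    have h8 : (1 : ℤ_[2]) ^ 2 - z = -(2 ^ 3 * t) := by linear_combination -ht
    rw [h8, norm_neg, norm_mul, norm_pow, mul_one, h2]
    have := PadicInt.norm_le_one t
    linarith
  obtain ⟨w, hw⟩ := PadicInt.exists_sq_eq_of_norm_lt hn
  refine ⟨w, ?_, hw⟩
  have hz : IsUnit z := by
    rw [PadicInt.isUnit_iff_toZMod_ne_zero, sub_eq_iff_eq_add.1 ht]
    have h8 : PadicInt.toZMod (8 : ℤ_[2]) = 0 :=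
      PadicInt.toZMod_eq_zero_iff_dvd.2 ⟨4, by norm_num⟩
    simp [h8]
  rw [← hw] at hz
  exact (isUnit_pow_iff two_ne_zero).1 hz

/-! ### Solubility under changes of the coefficients. -/

theorem mem_solubleSet_iff_exists_isUnit {p : ℕ} [Fact p.Prime] {n k : ℕ}
    {a : Fin (n + 1) → ℤ_[p]} :
    a ∈ solubleSet p n k ↔
      ∃ x : Fin (n + 1) → ℤ_[p], (∃ i, IsUnit (x i)) ∧ ∑ i, a i * x i ^ k = 0 := by
  rw [mem_solubleSet_iff]
  refine exists_congr fun x => and_congr_left fun _ => ?_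
  constructor
  · intro h
    by_contra! hx
    have : ‖x‖ < 1 := (pi_norm_lt_iff zero_lt_one).2 fun i => PadicInt.not_isUnit_iff.1 (hx i)
    linarith
  · rintro ⟨i, hi⟩
    refine le_antisymm
      ((pi_norm_le_iff_of_nonneg zero_le_one).2 fun i => PadicInt.norm_le_one _) ?_
    rw [← PadicInt.isUnit_iff.1 hi]
    exact norm_le_pi_norm x i

theorem mem_solubleSet_iff_exists_padic {p : ℕ} [Fact p.Prime] {n k : ℕ}
    {a : Fin (n + 1) → ℤ_[p]} :
    a ∈ solubleSet p n k ↔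
      ∃ x : Fin (n + 1) → ℚ_[p], x ≠ 0 ∧ ∑ i, (a i : ℚ_[p]) * x i ^ k = 0 :=
  diagonalHypersurface_nonempty_iff k _

theorem mem_solubleSet_of_ne_zero {p : ℕ} [Fact p.Prime] {n k : ℕ} {a x : Fin (n + 1) → ℤ_[p]}
    (hx : x ≠ 0) (h : ∑ i, a i * x i ^ k = 0) : a ∈ solubleSet p n k := by
  rw [mem_solubleSet_iff_exists_padic]
  refine ⟨fun i => x i, fun h0 => hx ?_, ?_⟩
  · funext i
    exact PadicInt.ext (by simpa using congrFun h0 i)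
  · rw [← padicInt_coe_sum_mul_pow, h, PadicInt.coe_zero]

/-- The factors `c i` are absorbed into the variables; this is invertible over `ℚ_p` even when `c i`
is not a unit. With `k = 2` only square classes of coefficients matter. -/
theorem mem_solubleSet_pow_mul_iff {p : ℕ} [Fact p.Prime] {n k : ℕ} {a b c : Fin (n + 1) → ℤ_[p]}
    (hc : ∀ i, c i ≠ 0) (h : ∀ i, a i = c i ^ k * b i) :
    a ∈ solubleSet p n k ↔ b ∈ solubleSet p n k := by
  have hc' : ∀ i, (c i : ℚ_[p]) ≠ 0 := fun i => PadicInt.coe_ne_zero.2 (hc i)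
  rw [mem_solubleSet_iff_exists_padic, mem_solubleSet_iff_exists_padic]
  constructor
  · rintro ⟨x, hx, hs⟩
    refine ⟨fun i => c i * x i, fun h0 => hx ?_, ?_⟩
    · funext i
      simpa [hc' i] using congrFun h0 i
    · rw [← hs]
      refine Finset.sum_congr rfl fun i _ => ?_
      rw [h i]
      push_cast
      ring
  · rintro ⟨x, hx, hs⟩
    refine ⟨fun i => x i / c i, fun h0 => hx ?_, ?_⟩
    · funext i
      simpa [hc' i] using congrFun h0 i
    · rw [← hs]
      refine Finset.sum_congr rfl fun i _ => ?_
      rw [h i, div_pow]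
      push_cast
      have := hc' i
      field_simp

theorem mem_solubleSet_smul_iff {p : ℕ} [Fact p.Prime] {n k : ℕ} {a b : Fin (n + 1) → ℤ_[p]}
    {c : ℤ_[p]} (hc : c ≠ 0) (h : ∀ i, a i = c * b i) :
    a ∈ solubleSet p n k ↔ b ∈ solubleSet p n k := by
  rw [mem_solubleSet_iff_exists_isUnit, mem_solubleSet_iff_exists_isUnit]
  refine exists_congr fun x => and_congr_right fun _ => ?_
  have : ∑ i, a i * x i ^ k = c * ∑ i, b i * x i ^ k := by
    rw [Finset.mul_sum]
    exact Finset.sum_congr rfl fun i _ => by rw [h i, mul_assoc]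
  rw [this, mul_eq_zero, or_iff_right hc]

/-- A zero of a subform extends by `0` in the other variables; `k ≠ 0` guards against `0 ^ 0 = 1`.
-/
theorem mem_solubleSet_of_comp {p : ℕ} [Fact p.Prime] {m n k : ℕ} (hk : k ≠ 0)
    {a : Fin (n + 1) → ℤ_[p]} {f : Fin (m + 1) → Fin (n + 1)} (hf : Function.Injective f)
    (h : a ∘ f ∈ solubleSet p m k) : a ∈ solubleSet p n k := by
  rw [mem_solubleSet_iff_exists_isUnit] at h ⊢
  obtain ⟨x, ⟨i, hi⟩, hs⟩ := h
  refine ⟨Function.extend f x 0, ⟨f i, by rwa [hf.extend_apply]⟩, ?_⟩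
  rw [← hs]
  refine (Fintype.sum_of_injective f hf _ _ (fun j hj => ?_) fun j => ?_).symm
  · rw [Function.extend_apply' _ _ _ (by simpa using hj)]
    simp [hk]
  · rw [hf.extend_apply]
    rfl

theorem mem_solubleSet_of_eq_zero {p : ℕ} [Fact p.Prime] {n k : ℕ} (hk : k ≠ 0)
    {a : Fin (n + 1) → ℤ_[p]} {i : Fin (n + 1)} (h : a i = 0) : a ∈ solubleSet p n k := by
  refine mem_solubleSet_of_ne_zero (x := Pi.single i 1) (by simp) ?_
  refine Finset.sum_eq_zero fun j _ => ?_
  by_cases hj : j = i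
  · rw [hj, h, zero_mul]
  · simp [Pi.single_eq_of_ne hj, hk]

/-! ### Odd `p`: the isotropy criterion. -/

/-- The sign `1` or `-1` attached to a Boolean. -/
def boolSign (s : Bool) : ℤ := if s then 1 else -1

theorem boolSign_ne_zero (s : Bool) : boolSign s ≠ 0 := by cases s <;> decide

theorem boolSign_injective : Function.Injective boolSign := by decide

/-- The `p`-adic units whose reduction has quadratic character `boolSign s`. -/
def quadraticUnits (p : ℕ) [Fact p.Prime] (s : Bool) : Set ℤ_[p] :=
  {u | quadraticChar (ZMod p) (PadicInt.toZMod u) = boolSign s}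

theorem isUnit_of_mem_quadraticUnits {p : ℕ} [Fact p.Prime] {s : Bool} {u : ℤ_[p]}
    (hu : u ∈ quadraticUnits p s) : IsUnit u := by
  rw [PadicInt.isUnit_iff_toZMod_ne_zero]
  intro h0
  have h : quadraticChar (ZMod p) (PadicInt.toZMod u) = boolSign s := hu
  rw [h0, MulChar.map_zero] at h
  exact boolSign_ne_zero s h.symm

theorem exists_mem_quadraticUnits {p : ℕ} [Fact p.Prime] {u : ℤ_[p]} (hu : IsUnit u) :
    ∃ s, u ∈ quadraticUnits p s := by
  rcases quadraticChar_dichotomy (PadicInt.isUnit_iff_toZMod_ne_zero.1 hu) with h | h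
  · exact ⟨true, h⟩
  · exact ⟨false, h⟩

theorem disjoint_quadraticUnits {p : ℕ} [Fact p.Prime] {s t : Bool} (h : s ≠ t) :
    Disjoint (quadraticUnits p s) (quadraticUnits p t) := by
  rw [Set.disjoint_left]
  intro u hu hu'
  exact h (boolSign_injective (Eq.trans (Eq.symm hu) hu'))

/-- The character sums to zero, so squares and nonsquares are equally many among the `p - 1` nonzero
residues. -/
theorem card_filter_quadraticChar_eq {p : ℕ} [Fact p.Prime] (hp : p ≠ 2) (s : Bool) :
    ((Finset.univ.filter fun t : ZMod p => quadraticChar (ZMod p) t = boolSign s).card : ℝ)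
      = ((p : ℝ) - 1) / 2 := by
  have hodd : ringChar (ZMod p) ≠ 2 := by rwa [ZMod.ringChar_zmod_n]
  have hsum := quadraticChar_sum_zero (F := ZMod p) hodd
  have hpt : ∀ t : ZMod p, quadraticChar (ZMod p) t
      = (if quadraticChar (ZMod p) t = 1 then 1 else 0)
        - (if quadraticChar (ZMod p) t = -1 then 1 else 0) := by
    intro t
    by_cases h : t = 0
    · subst h; simp
    · rcases quadraticChar_dichotomy h with h | h <;> simp [h]
  have hone : ∀ t : ZMod p, (1 : ℤ)
      = (if quadraticChar (ZMod p) t = 1 then 1 else 0)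
        + (if quadraticChar (ZMod p) t = -1 then 1 else 0) + if t = 0 then 1 else 0 := by
    intro t
    by_cases h : t = 0
    · subst h; simp
    · rcases quadraticChar_dichotomy h with h' | h' <;> simp [h, h']
  have hcard : ∑ t : ZMod p, (1 : ℤ) = p := by simp
  rw [Finset.sum_congr rfl fun t _ => hpt t, Finset.sum_sub_distrib, Finset.sum_boole,
    Finset.sum_boole] at hsum
  rw [Finset.sum_congr rfl fun t _ => hone t, Finset.sum_add_distrib, Finset.sum_add_distrib,
    Finset.sum_boole, Finset.sum_boole, Finset.sum_ite_eq'] at hcard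
  simp only [Finset.mem_univ, if_true] at hsum hcard
  have h1 := congrArg (Int.cast : ℤ → ℝ) hsum
  have h2 := congrArg (Int.cast : ℤ → ℝ) hcard
  push_cast at h1 h2
  cases s
  · simp only [boolSign, Bool.false_eq_true, if_false]
    linarith
  · simp only [boolSign, if_true]
    linarith

theorem padicHaar_quadraticUnits {p : ℕ} [Fact p.Prime] (hp : p ≠ 2) (s : Bool) :
    MeasurableSet (quadraticUnits p s) ∧
      (padicHaar p).real (quadraticUnits p s) = ((p : ℝ) - 1) / 2 * (p : ℝ)⁻¹ := by
  have : NeZero p := ⟨(Fact.out : p.Prime).ne_zero⟩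
  have h := padicHaar_real_preimage (PadicInt.toZMod (p := p)) (PadicInt.prime_p.ne_zero)
    (by rw [PadicInt.ker_toZMod, PadicInt.maximalIdeal_eq_span_p])
    (Finset.univ.filter fun t : ZMod p => quadraticChar (ZMod p) t = boolSign s)
  rw [card_filter_quadraticChar_eq hp] at h
  have heq : quadraticUnits p s = PadicInt.toZMod (p := p) ⁻¹'
      (Finset.univ.filter fun t : ZMod p => quadraticChar (ZMod p) t = boolSign s : Finset _) := by
    ext u
    simp [quadraticUnits]
  rw [heq]
  exact h

/-- The combinatorial criterion for isotropy over `ℚ_p`, `p` odd, of a diagonal quadratic form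
whose `i`-th coefficient has valuation of parity `(c i).1` and unit part of quadratic character
`boolSign (c i).2`. Here `ε` records whether `-1` is a square modulo `p`. -/
def IsotropicClasses (ε : Bool) {n : ℕ} (c : Fin n → Bool × Bool) : Prop :=
  (∃ i j, i ≠ j ∧ (c i).1 = (c j).1 ∧ ε = ((c i).2 == (c j).2)) ∨
    ∃ e, 2 < (Finset.univ.filter fun i => (c i).1 = e).card

instance (ε : Bool) {n : ℕ} : DecidablePred (IsotropicClasses ε (n := n)) := fun c => by
  unfold IsotropicClasses
  infer_instance

theorem isSquare_neg_mul_iff {p : ℕ} [Fact p.Prime] {ε s t : Bool} {u v : ℤ_[p]}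
    (hε : quadraticChar (ZMod p) (-1) = boolSign ε) (hu : u ∈ quadraticUnits p s)
    (hv : v ∈ quadraticUnits p t) :
    IsSquare (PadicInt.toZMod (-(u * v))) ↔ ε = (s == t) := by
  have hne : PadicInt.toZMod (-(u * v)) ≠ 0 :=
    PadicInt.isUnit_iff_toZMod_ne_zero.1
      ((isUnit_of_mem_quadraticUnits hu).mul (isUnit_of_mem_quadraticUnits hv)).neg
  have hu' : quadraticChar (ZMod p) (PadicInt.toZMod u) = boolSign s := hu
  have hv' : quadraticChar (ZMod p) (PadicInt.toZMod v) = boolSign t := hv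
  have hmul : PadicInt.toZMod (-(u * v)) = -1 * PadicInt.toZMod u * PadicInt.toZMod v := by
    rw [map_neg, map_mul]; ring
  rw [← quadraticChar_one_iff_isSquare hne, hmul, map_mul, map_mul, hε, hu', hv']
  cases ε <;> cases s <;> cases t <;> decide

theorem mem_solubleSet_one_of_isSquare {p : ℕ} [Fact p.Prime] (hp : p ≠ 2) {a : Fin 2 → ℤ_[p]}
    (h0 : IsUnit (a 0)) (h1 : IsUnit (a 1)) (h : IsSquare (PadicInt.toZMod (-(a 0 * a 1)))) :
    a ∈ solubleSet p 1 2 := by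
  obtain ⟨w, hw⟩ := PadicInt.exists_sq_eq_of_isSquare_toZMod hp (h0.mul h1).neg h
  -- Since `w ^ 2 = -(a 0 * a 1)`, the vector `(a 1, w)` is a zero.
  refine mem_solubleSet_of_ne_zero (x := ![a 1, w]) ?_ ?_
  · intro hx
    exact h1.ne_zero (congrFun hx 0)
  · refine (Fin.sum_univ_two _).trans ?_
    change a 0 * a 1 ^ 2 + a 1 * w ^ 2 = 0
    rw [hw]
    ring

/-- Over `𝔽_p` the equation `a₀ x² + a₁ y² = -a₂` is solvable. Lifting `x` and `y` arbitrarily makes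
`-(a₀ x² + a₁ y²) / a₂` congruent to `1`, hence a square `w²`, and `(x, y, w)` is an exact zero. -/
theorem mem_solubleSet_two_of_isUnit {p : ℕ} [Fact p.Prime] (hp : p ≠ 2) {a : Fin 3 → ℤ_[p]}
    (ha : ∀ i, IsUnit (a i)) : a ∈ solubleSet p 2 2 := by
  have hne : ∀ i, PadicInt.toZMod (a i) ≠ 0 :=
    fun i => PadicInt.isUnit_iff_toZMod_ne_zero.1 (ha i)
  obtain ⟨b, c, hbc⟩ := FiniteField.exists_root_sum_quadratic
    (f := Polynomial.C (PadicInt.toZMod (a 0)) * Polynomial.X ^ 2 + Polynomial.C 0 * Polynomial.X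
      + Polynomial.C (PadicInt.toZMod (a 2)))
    (g := Polynomial.C (PadicInt.toZMod (a 1)) * Polynomial.X ^ 2 + Polynomial.C 0 * Polynomial.X
      + Polynomial.C 0)
    (Polynomial.degree_quadratic (hne 0)) (Polynomial.degree_quadratic (hne 1))
    (by rw [ZMod.card]; exact Nat.odd_iff.1 ((Fact.out : p.Prime).odd_of_ne_two hp))
  obtain ⟨x, rfl⟩ := ZMod.ringHom_surjective (PadicInt.toZMod (p := p)) b
  obtain ⟨y, rfl⟩ := ZMod.ringHom_surjective (PadicInt.toZMod (p := p)) c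
  simp only [Polynomial.eval_add, Polynomial.eval_mul, Polynomial.eval_C, Polynomial.eval_pow,
    Polynomial.eval_X, zero_mul, add_zero] at hbc
  obtain ⟨v, hv⟩ := (ha 2).exists_left_inv
  have hred : PadicInt.toZMod (-(v * (a 0 * x ^ 2 + a 1 * y ^ 2))) = 1 := by
    have hv' : PadicInt.toZMod v * PadicInt.toZMod (a 2) = 1 := by rw [← map_mul, hv, map_one]
    simp only [map_neg, map_mul, map_add, map_pow]
    linear_combination hv' - PadicInt.toZMod v * hbc
  obtain ⟨w, hw⟩ := PadicInt.exists_sq_eq_of_isSquare_toZMod hp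
    (PadicInt.isUnit_iff_toZMod_ne_zero.2 (by rw [hred]; exact one_ne_zero))
    (by rw [hred]; exact IsSquare.one)
  refine mem_solubleSet_of_ne_zero (x := ![x, y, w]) ?_ ?_
  · intro hx
    have hw0 : w = 0 := congrFun hx 2
    have : PadicInt.toZMod (w ^ 2) = 1 := by rw [hw, hred]
    simp [hw0] at this
  · refine (Fin.sum_univ_three _).trans ?_
    change a 0 * x ^ 2 + a 1 * y ^ 2 + a 2 * w ^ 2 = 0
    rw [hw]
    linear_combination -(a 0 * x ^ 2 + a 1 * y ^ 2) * hv

/-- A diagonal quadratic form in at most two variables is anisotropic if no two of its coefficients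
have product minus a square. -/
theorem eq_zero_of_sum_mul_sq_eq_zero {F ι : Type*} [Field F] {I : Finset ι} (hI : I.card ≤ 2)
    {u x : ι → F} (hu : ∀ i ∈ I, u i ≠ 0)
    (hns : ∀ i ∈ I, ∀ j ∈ I, i ≠ j → ¬ IsSquare (-(u i * u j)))
    (h : ∑ i ∈ I, u i * x i ^ 2 = 0) : ∀ i ∈ I, x i = 0 := by
  classical
  interval_cases hc : I.card
  · simp [Finset.card_eq_zero.1 hc]
  · obtain ⟨i, rfl⟩ := Finset.card_eq_one.1 hc
    have := hu i (by simp)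
    simpa [this] using h
  · obtain ⟨i, j, hij, rfl⟩ := Finset.card_eq_two.1 hc
    rw [Finset.sum_pair hij] at h
    have hi := hu i (by simp)
    have hj := hu j (by simp)
    have hj0 : x j = 0 := by
      by_contra hxj
      -- From `u i * x i ^ 2 = -u j * x j ^ 2`, the square of `u i * x i / x j` is `-(u i * u j)`.
      refine hns i (by simp) j (by simp) hij ⟨u i * x i / x j, ?_⟩
      field_simp
      linear_combination -h
    have hi0 : x i = 0 := by simpa [hj0, hi] using h
    simp [hi0, hj0]

theorem PadicInt.dvd_of_dvd_sum_mul_sq {p : ℕ} [Fact p.Prime] {ι : Type*} {I : Finset ι}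
    (hI : I.card ≤ 2) {u x : ι → ℤ_[p]} (hu : ∀ i ∈ I, IsUnit (u i))
    (hns : ∀ i ∈ I, ∀ j ∈ I, i ≠ j → ¬ IsSquare (PadicInt.toZMod (-(u i * u j))))
    (h : (p : ℤ_[p]) ∣ ∑ i ∈ I, u i * x i ^ 2) : ∀ i ∈ I, (p : ℤ_[p]) ∣ x i := by
  intro i hi
  rw [← PadicInt.toZMod_eq_zero_iff_dvd] at h ⊢
  refine eq_zero_of_sum_mul_sq_eq_zero (u := fun i => PadicInt.toZMod (u i))
    (x := fun i => PadicInt.toZMod (x i)) hI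
    (fun i hi => PadicInt.isUnit_iff_toZMod_ne_zero.1 (hu i hi)) ?_ ?_ i hi
  · intro i hi j hj hij
    simpa using hns i hi j hj hij
  · simpa using h

/-- Springer's argument. After removing even powers of `p` the form is `f₀ + p f₁`. If both blocks
are anisotropic modulo `p`, a zero has `p ∣ f₀`, so `p` divides the variables of `f₀`; then `p² ∣
f₀`, so `p ∣ f₁` and `p` divides the remaining variables, against primitivity. Conversely, an
isotropic pair or any three coefficients of one parity give a soluble subform. -/
theorem mem_solubleSet_iff_isotropicClasses {p : ℕ} [Fact p.Prime] (hp : p ≠ 2) {ε : Bool}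
    (hε : quadraticChar (ZMod p) (-1) = boolSign ε) {n : ℕ} {a : Fin (n + 1) → ℤ_[p]}
    {c : Fin (n + 1) → Bool × Bool}
    (hac : ∀ i, a i ∈ parityClass p (c i).1 (quadraticUnits p (c i).2)) :
    a ∈ solubleSet p n 2 ↔ IsotropicClasses ε c := by
  have hp0 : (p : ℤ_[p]) ≠ 0 := PadicInt.prime_p.ne_zero
  choose k u hu hau using fun i => mem_parityClass.1 (hac i)
  have hunit : ∀ i, IsUnit (u i) := fun i => isUnit_of_mem_quadraticUnits (hu i)
  rw [mem_solubleSet_pow_mul_iff (b := fun i => (p : ℤ_[p]) ^ (c i).1.toNat * u i)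
    (c := fun i => (p : ℤ_[p]) ^ k i) (fun i => pow_ne_zero _ hp0) fun i => by rw [← hau i]; ring]
  constructor
  · intro hsol
    by_contra hcon
    rw [IsotropicClasses, not_or] at hcon
    obtain ⟨hpair, htriple⟩ := hcon
    push Not at hpair htriple
    obtain ⟨x, ⟨i₀, hi₀⟩, hx⟩ := mem_solubleSet_iff_exists_isUnit.1 hsol
    have hdvd : ∀ e, (p : ℤ_[p]) ∣ ∑ i with (c i).1 = e, u i * x i ^ 2 →
        ∀ i, (c i).1 = e → (p : ℤ_[p]) ∣ x i := by
      intro e he i hi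
      refine PadicInt.dvd_of_dvd_sum_mul_sq (htriple e) (fun i _ => hunit i) ?_ he i (by simpa)
      intro i hi j hj hij
      simp only [Finset.mem_filter, Finset.mem_univ, true_and] at hi hj
      rw [isSquare_neg_mul_iff hε (hu i) (hu j)]
      exact hpair i j hij (hi.trans hj.symm)
    have hsplit : ∑ i with (c i).1 = false, u i * x i ^ 2
        + p * ∑ i with (c i).1 = true, u i * x i ^ 2 = 0 := by
      rw [← hx, ← Finset.sum_filter_add_sum_filter_not Finset.univ fun i => (c i).1 = false,
        Finset.mul_sum]
      simp only [Bool.not_eq_false]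
      congr 1
      · refine Finset.sum_congr rfl fun i hi => ?_
        rw [(Finset.mem_filter.1 hi).2]
        simp
      · refine Finset.sum_congr rfl fun i hi => ?_
        rw [(Finset.mem_filter.1 hi).2]
        simp [mul_assoc]
    have hfalse : ∀ i, (c i).1 = false → (p : ℤ_[p]) ∣ x i :=
      hdvd false ⟨-∑ i with (c i).1 = true, u i * x i ^ 2, by linear_combination hsplit⟩
    have htrue : ∀ i, (c i).1 = true → (p : ℤ_[p]) ∣ x i := by
      refine hdvd true ?_
      have hsq : (p : ℤ_[p]) ^ 2 ∣ ∑ i with (c i).1 = false, u i * x i ^ 2 :=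
        Finset.dvd_sum fun i hi =>
          Dvd.dvd.mul_left (pow_dvd_pow_of_dvd (hfalse i (Finset.mem_filter.1 hi).2) 2) _
      obtain ⟨t, ht⟩ := hsq
      refine ⟨-t, mul_left_cancel₀ hp0 ?_⟩
      linear_combination hsplit - ht
    have : (p : ℤ_[p]) ∣ x i₀ := by
      cases h : (c i₀).1
      exacts [hfalse i₀ h, htrue i₀ h]
    exact PadicInt.prime_p.not_isUnit (isUnit_of_dvd_unit this hi₀)
  · rintro (⟨i, j, hij, he, hs⟩ | ⟨e, he⟩)
    · refine mem_solubleSet_of_comp (m := 1) (f := ![i, j]) two_ne_zero ?_ ?_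
      · intro a b hab
        fin_cases a <;> fin_cases b <;> simp_all [eq_comm]
      · rw [mem_solubleSet_smul_iff (b := ![u i, u j]) (pow_ne_zero (c i).1.toNat hp0)]
        · exact mem_solubleSet_one_of_isSquare hp (hunit i) (hunit j)
            ((isSquare_neg_mul_iff hε (hu i) (hu j)).2 hs)
        · intro l
          fin_cases l <;> simp [he]
    · obtain ⟨i, hi, j, hj, k, hk, hij, hik, hjk⟩ := Finset.two_lt_card.1 he
      simp only [Finset.mem_filter, Finset.mem_univ, true_and] at hi hj hk
      refine mem_solubleSet_of_comp (m := 2) (f := ![i, j, k]) two_ne_zero ?_ ?_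
      · intro a b hab
        fin_cases a <;> fin_cases b <;> simp_all [eq_comm]
      · rw [mem_solubleSet_smul_iff (b := ![u i, u j, u k]) (pow_ne_zero e.toNat hp0)]
        · refine mem_solubleSet_two_of_isUnit hp fun l => ?_
          fin_cases l
          exacts [hunit i, hunit j, hunit k]
        · intro l
          fin_cases l <;> simp [hi, hj, hk]

/-! ### `p = 2`: solubility is decided modulo `16`. -/

/-- Decides whether `t + ∑ a * x ^ 2`, with `a` running over the list, vanishes modulo `16` for some
integers `x`, not all even unless `o` is `true`. -/
def hasZeroModSixteen : List ℕ → ℕ → Bool → Bool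
  | [], t, o => o && t % 16 == 0
  | a :: l, t, o => hasZeroModSixteen l (t + a) true || hasZeroModSixteen l t o ||
      hasZeroModSixteen l (t + 4 * a) o || hasZeroModSixteen l (t + 9 * a) true

/-- The residues `0, 1, 4, 9` are the four branches of `hasZeroModSixteen`, attained at `0, 1, 2,
3`; the odd ones raise the flag. -/
theorem Nat.sq_mod_sixteen (x : ℕ) : ∃ k, (Odd x ∧ (x ^ 2 = 1 + 16 * k ∨ x ^ 2 = 9 + 16 * k)) ∨
    (¬ Odd x ∧ (x ^ 2 = 16 * k ∨ x ^ 2 = 4 + 16 * k)) := by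
  obtain ⟨q, r, hr, rfl⟩ : ∃ q r, r < 8 ∧ x = 8 * q + r :=
    ⟨x / 8, x % 8, Nat.mod_lt _ (by norm_num), (Nat.div_add_mod x 8).symm⟩
  interval_cases r
  · exact ⟨4 * q ^ 2, Or.inr ⟨by simp [parity_simps], Or.inl (by ring)⟩⟩
  · exact ⟨4 * q ^ 2 + q, Or.inl ⟨by simp [parity_simps], Or.inl (by ring)⟩⟩
  · exact ⟨4 * q ^ 2 + 2 * q, Or.inr ⟨by simp [parity_simps], Or.inr (by ring)⟩⟩
  · exact ⟨4 * q ^ 2 + 3 * q, Or.inl ⟨by simp [parity_simps], Or.inr (by ring)⟩⟩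
  · exact ⟨4 * q ^ 2 + 4 * q + 1, Or.inr ⟨by simp [parity_simps], Or.inl (by ring)⟩⟩
  · exact ⟨4 * q ^ 2 + 5 * q + 1, Or.inl ⟨by simp [parity_simps], Or.inr (by ring)⟩⟩
  · exact ⟨4 * q ^ 2 + 6 * q + 2, Or.inr ⟨by simp [parity_simps], Or.inr (by ring)⟩⟩
  · exact ⟨4 * q ^ 2 + 7 * q + 3, Or.inl ⟨by simp [parity_simps], Or.inl (by ring)⟩⟩

theorem hasZeroModSixteen_ofFn {n : ℕ} (f : Fin n → ℕ) (t : ℕ) (o : Bool) :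
    hasZeroModSixteen (List.ofFn f) t o = true ↔
      ∃ x : Fin n → ℕ, (o = true ∨ ∃ i, Odd (x i)) ∧ 16 ∣ t + ∑ i, f i * x i ^ 2 := by
  induction n generalizing t o with
  | zero => simp [hasZeroModSixteen, Nat.dvd_iff_mod_eq_zero]
  | succ n ih =>
    rw [List.ofFn_succ, hasZeroModSixteen]
    simp only [Bool.or_eq_true, ih, Fin.sum_univ_succ, true_or, true_and]
    constructor
    · rintro (((⟨x, h⟩ | ⟨x, ho, h⟩) | ⟨x, ho, h⟩) | ⟨x, h⟩)
      · refine ⟨Fin.cons 1 x, Or.inr ⟨0, by simp⟩, ?_⟩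
        simpa [← add_assoc] using h
      · refine ⟨Fin.cons 0 x, ho.imp_right fun ⟨i, hi⟩ => ⟨i.succ, by simpa using hi⟩, ?_⟩
        simpa using h
      · refine ⟨Fin.cons 2 x, ho.imp_right fun ⟨i, hi⟩ => ⟨i.succ, by simpa using hi⟩, ?_⟩
        simpa [← add_assoc, mul_comm] using h
      · refine ⟨Fin.cons 3 x, Or.inr ⟨0, by simp; decide⟩, ?_⟩
        simpa [← add_assoc, mul_comm] using h
    · rintro ⟨x, ho, h⟩
      have htail : ¬ Odd (x 0) → (o = true ∨ ∃ i : Fin n, Odd (x i.succ)) := by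
        intro h0
        refine ho.imp_right ?_
        rintro ⟨i, hi⟩
        refine Fin.cases (fun h => absurd h h0) (fun j hj => ⟨j, hj⟩) i hi
      -- Only `x 0 ^ 2` modulo `16` matters, so it may be replaced by its residue `r`.
      have hred : ∀ r k, x 0 ^ 2 = r + 16 * k →
          16 ∣ t + r * f 0 + ∑ i : Fin n, f i.succ * x i.succ ^ 2 := by
        intro r k hrk
        rw [hrk] at h
        refine (Nat.dvd_add_right (Dvd.intro (f 0 * k) rfl)).1 ?_
        convert h using 1
        ring
      obtain ⟨k, ⟨-, hk | hk⟩ | ⟨h0, hk | hk⟩⟩ := Nat.sq_mod_sixteen (x 0)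
      · exact Or.inl (Or.inl (Or.inl ⟨_, by simpa using hred _ _ hk⟩))
      · exact Or.inr ⟨_, hred _ _ hk⟩
      · exact Or.inl (Or.inl (Or.inr ⟨_, htail h0, by simpa using hred 0 k (by simpa using hk)⟩))
      · exact Or.inl (Or.inr ⟨_, htail h0, hred _ _ hk⟩)

/-- The representative `2 ^ e * (2 * r + 1)` of a class of nonzero `2`-adic numbers modulo
squares. -/
def dyadicRep (c : Bool × Fin 4) : ℕ := 2 ^ c.1.toNat * (2 * c.2 + 1)

/-- The `2`-adic units congruent to `2 * r + 1` modulo `8`. -/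
def dyadicUnits (r : Fin 4) : Set ℤ_[2] := PadicInt.toZModPow 3 ⁻¹' {2 * (r : ZMod (2 ^ 3)) + 1}

theorem PadicInt.toZModPow_eq_zero_iff_dvd {p : ℕ} [Fact p.Prime] {n : ℕ} {x : ℤ_[p]} :
    PadicInt.toZModPow n x = 0 ↔ (p : ℤ_[p]) ^ n ∣ x := by
  rw [← RingHom.mem_ker, PadicInt.ker_toZModPow, Ideal.mem_span_singleton]

theorem mem_dyadicUnits_iff_dvd {r : Fin 4} {u : ℤ_[2]} :
    u ∈ dyadicUnits r ↔ 8 ∣ u - (2 * (r : ℕ) + 1 : ℕ) := by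
  have h8 : (8 : ℤ_[2]) = ((2 : ℕ) : ℤ_[2]) ^ 3 := by norm_num
  have hr : ∀ r : Fin 4, 2 * (r : ZMod (2 ^ 3)) + 1 = ((2 * (r : ℕ) + 1 : ℕ) : ZMod (2 ^ 3)) := by
    decide
  rw [h8, ← PadicInt.toZModPow_eq_zero_iff_dvd, map_sub, sub_eq_zero, map_natCast, dyadicUnits,
    Set.mem_preimage, Set.mem_singleton_iff, hr]

theorem PadicInt.isUnit_natCast_of_odd {m : ℕ} (hm : Odd m) : IsUnit (m : ℤ_[2]) := by
  rw [PadicInt.isUnit_iff_toZMod_ne_zero, map_natCast, Ne, ZMod.natCast_eq_zero_iff]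
  exact hm.not_two_dvd_nat

/-- Dividing `u` by the odd integer `2 * r + 1` gives a unit congruent to `1` modulo `8`, which is a
square. -/
theorem dyadicUnits_eq_mul_sq {r : Fin 4} {u : ℤ_[2]} (hu : u ∈ dyadicUnits r) :
    ∃ w, IsUnit w ∧ u = w ^ 2 * (2 * (r : ℕ) + 1 : ℕ) := by
  obtain ⟨t, ht⟩ := mem_dyadicUnits_iff_dvd.1 hu
  obtain ⟨v, hv⟩ := (PadicInt.isUnit_natCast_of_odd (m := 2 * (r : ℕ) + 1) ⟨r, rfl⟩).exists_left_inv
  obtain ⟨w, hw, hwu⟩ := PadicInt.exists_isUnit_sq_eq_of_dvd (z := v * u)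
    ⟨v * t, by linear_combination v * ht + hv⟩
  exact ⟨w, hw, by rw [hwu]; linear_combination (-u) * hv⟩

theorem isUnit_of_mem_dyadicUnits {r : Fin 4} {u : ℤ_[2]} (hu : u ∈ dyadicUnits r) :
    IsUnit u := by
  obtain ⟨w, hw, rfl⟩ := dyadicUnits_eq_mul_sq hu
  exact (hw.pow 2).mul (PadicInt.isUnit_natCast_of_odd ⟨r, rfl⟩)

theorem exists_mem_dyadicUnits {u : ℤ_[2]} (hu : IsUnit u) : ∃ r, u ∈ dyadicUnits r := by
  obtain ⟨v, hv⟩ := hu.exists_right_inv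
  have h : PadicInt.toZModPow 3 u * PadicInt.toZModPow 3 v = 1 := by
    rw [← map_mul, hv, map_one]
  have key : ∀ y z : ZMod (2 ^ 3), y * z = 1 → ∃ r : Fin 4, y = 2 * (r : ZMod (2 ^ 3)) + 1 := by
    decide
  exact key _ _ h

theorem disjoint_dyadicUnits {r s : Fin 4} (h : r ≠ s) :
    Disjoint (dyadicUnits r) (dyadicUnits s) := by
  refine Disjoint.preimage _ ?_
  rw [Set.disjoint_singleton]
  revert r s
  decide

theorem padicHaar_dyadicUnits (r : Fin 4) :
    MeasurableSet (dyadicUnits r) ∧ (padicHaar 2).real (dyadicUnits r) = 1 / 8 := by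
  have h := padicHaar_real_fiber (PadicInt.toZModPow (p := 2) 3) (a := ((2 : ℕ) : ℤ_[2]) ^ 3)
    (pow_ne_zero _ PadicInt.prime_p.ne_zero) (PadicInt.ker_toZModPow 3)
    (2 * (r : ZMod (2 ^ 3)) + 1)
  refine ⟨h.1, h.2.trans ?_⟩
  norm_num

/-- Modulus `16` suffices because each coefficient has valuation at most `1`. If the form equals `16
t` at `x` with `x i` odd, cancelling the error means replacing `x i ^ 2` by `x i ^ 2 - 16 t / f i`.
Here `16 / f i` is divisible by `8`, so the new value is still `1` modulo `8`, hence a square. -/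
theorem natCast_mem_solubleSet_iff {n : ℕ} {f : Fin (n + 1) → ℕ} {c : Fin (n + 1) → Bool × Fin 4}
    (hf : ∀ i, f i = dyadicRep (c i)) :
    (fun i => (f i : ℤ_[2])) ∈ solubleSet 2 n 2 ↔ hasZeroModSixteen (List.ofFn f) 0 false := by
  rw [hasZeroModSixteen_ofFn, mem_solubleSet_iff_exists_isUnit]
  simp only [Bool.false_eq_true, false_or, zero_add]
  constructor
  · rintro ⟨x, ⟨i, hi⟩, hx⟩
    refine ⟨fun i => (PadicInt.toZModPow 4 (x i)).val, ⟨i, ?_⟩, ?_⟩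
    · have h := hi.map (PadicInt.toZModPow (p := 2) 4)
      rw [← ZMod.natCast_zmod_val (PadicInt.toZModPow 4 (x i)), ZMod.isUnit_iff_coprime] at h
      exact Nat.coprime_two_right.1 (Nat.Coprime.coprime_dvd_right (by norm_num) h)
    · have h := congrArg (PadicInt.toZModPow (p := 2) 4) hx
      rw [map_sum, map_zero] at h
      change 2 ^ 4 ∣ _
      rw [← ZMod.natCast_eq_zero_iff, ← h]
      push_cast
      refine Finset.sum_congr rfl fun i _ => ?_
      rw [ZMod.natCast_zmod_val]
      simp
  · rintro ⟨x, ⟨i, hi⟩, t, ht⟩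
    obtain ⟨v, hv⟩ := (PadicInt.isUnit_natCast_of_odd
      (m := 2 * ((c i).2 : ℕ) + 1) ⟨(c i).2, rfl⟩).exists_left_inv
    have hfi : (f i : ℤ_[2]) = 2 ^ (c i).1.toNat * (2 * ((c i).2 : ℕ) + 1 : ℕ) := by
      rw [hf i, dyadicRep]
      push_cast
      ring
    -- `v` inverts the odd part of `f i`, and the power of `2` complements the valuation of `f i` to
    -- `1`.
    have h16 : (16 : ℤ_[2]) = 8 * (2 ^ (!(c i).1).toNat * (f i * v)) := by
      rw [hfi]
      cases (c i).1
      · simp only [Bool.not_false, Bool.toNat_true, Bool.toNat_false]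
        linear_combination (-16) * hv
      · simp only [Bool.not_true, Bool.toNat_true, Bool.toNat_false]
        linear_combination (-16) * hv
    obtain ⟨m, hm⟩ : ∃ m, (x i : ℤ_[2]) ^ 2 = 1 + 8 * m := by
      obtain ⟨k, ⟨-, hk | hk⟩ | ⟨h0, -⟩⟩ := Nat.sq_mod_sixteen (x i)
      · exact ⟨2 * k, by rw [← Nat.cast_pow, hk]; push_cast; ring⟩
      · exact ⟨2 * k + 1, by rw [← Nat.cast_pow, hk]; push_cast; ring⟩
      · exact absurd hi h0
    obtain ⟨y, hy, hyx⟩ := PadicInt.exists_isUnit_sq_eq_of_dvd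
      (z := (x i : ℤ_[2]) ^ 2 - 8 * (2 ^ (!(c i).1).toNat * v * t))
      ⟨m - 2 ^ (!(c i).1).toNat * v * t, by rw [hm]; ring⟩
    refine ⟨Function.update (fun j => (x j : ℤ_[2])) i y, ⟨i, by simpa using hy⟩, ?_⟩
    have ht' : ∑ j, (f j : ℤ_[2]) * (x j : ℤ_[2]) ^ 2 = 16 * t := by exact_mod_cast ht
    rw [← Finset.add_sum_erase _ _ (Finset.mem_univ i)] at ht' ⊢
    rw [Finset.sum_congr rfl fun j hj => by
      rw [Function.update_of_ne (Finset.ne_of_mem_erase hj)]]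
    rw [Function.update_self, hyx]
    linear_combination ht' + (t : ℤ_[2]) * h16

theorem mem_solubleSet_iff_hasZeroModSixteen {n : ℕ} {a : Fin (n + 1) → ℤ_[2]}
    {c : Fin (n + 1) → Bool × Fin 4}
    (hac : ∀ i, a i ∈ parityClass 2 (c i).1 (dyadicUnits (c i).2)) :
    a ∈ solubleSet 2 n 2 ↔ hasZeroModSixteen (List.ofFn fun i => dyadicRep (c i)) 0 false := by
  rw [← natCast_mem_solubleSet_iff fun i => rfl]
  have h2 : (2 : ℤ_[2]) ≠ 0 := two_ne_zero
  choose k u hu hau using fun i => mem_parityClass.1 (hac i)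
  choose w hw huw using fun i => dyadicUnits_eq_mul_sq (hu i)
  refine mem_solubleSet_pow_mul_iff (c := fun i => 2 ^ k i * w i)
    (fun i => mul_ne_zero (pow_ne_zero _ h2) (hw i).ne_zero) fun i => ?_
  rw [← hau i, huw i, dyadicRep]
  push_cast
  ring

/-! ### Five variables over `ℚ_2`. -/

theorem exists_three_of_same_parity (e : Fin 5 → Bool) :
    ∃ i j k l m : Fin 5, e i = e j ∧ e i = e k ∧ Function.Injective ![i, j, k, l, m] := by
  revert e
  decide +kernel

-- Three coefficients may be taken odd, by pigeonhole and scaling by `2`, which leaves `4³ · 8²`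
-- cases.
set_option maxRecDepth 100000 in
theorem hasZeroModSixteen_five : ∀ (r s t : Fin 4) (c d : Bool × Fin 4),
    hasZeroModSixteen [dyadicRep (false, r), dyadicRep (false, s), dyadicRep (false, t),
      dyadicRep c, dyadicRep d] 0 false = true := by
  decide +kernel

/-- Scaling the form by `2` flips every valuation parity, up to the square factor `4`. -/
theorem natCast_mem_solubleSet_not_iff {n : ℕ} (c : Fin (n + 1) → Bool × Fin 4) :
    (fun i => (dyadicRep (c i) : ℤ_[2])) ∈ solubleSet 2 n 2 ↔
      (fun i => (dyadicRep (!(c i).1, (c i).2) : ℤ_[2])) ∈ solubleSet 2 n 2 := by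
  have h2 : (2 : ℤ_[2]) ≠ 0 := two_ne_zero
  rw [← mem_solubleSet_smul_iff h2
    (a := fun i => 2 * (dyadicRep (c i) : ℤ_[2])) fun i => rfl]
  refine mem_solubleSet_pow_mul_iff (c := fun i => 2 ^ (c i).1.toNat)
    (fun i => pow_ne_zero _ h2) fun i => ?_
  rw [dyadicRep, dyadicRep]
  cases (c i).1
  · simp
  · simp only [Bool.toNat_true, Bool.not_true, Bool.toNat_false]
    push_cast
    ring

theorem natCast_mem_solubleSet_four (c : Fin 5 → Bool × Fin 4) :
    (fun i => (dyadicRep (c i) : ℤ_[2])) ∈ solubleSet 2 4 2 := by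
  obtain ⟨i, j, k, l, m, hij, hik, hinj⟩ := exists_three_of_same_parity fun i => (c i).1
  have key : ∀ c : Fin 5 → Bool × Fin 4, (c i).1 = (c j).1 → (c i).1 = (c k).1 →
      (c i).1 = false → (fun i => (dyadicRep (c i) : ℤ_[2])) ∈ solubleSet 2 4 2 := by
    intro c hij hik hi
    refine mem_solubleSet_of_comp (m := 4) two_ne_zero hinj ?_
    refine (natCast_mem_solubleSet_iff (c := fun x => c (![i, j, k, l, m] x))
      (fun x => rfl)).2 ?_
    have h := hasZeroModSixteen_five (c i).2 (c j).2 (c k).2 (c l) (c m)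
    have hi' : (false, (c i).2) = c i := Prod.ext hi.symm rfl
    have hj' : (false, (c j).2) = c j := Prod.ext (hi.symm.trans hij) rfl
    have hk' : (false, (c k).2) = c k := Prod.ext (hi.symm.trans hik) rfl
    rw [hi', hj', hk'] at h
    exact h
  cases hi : (c i).1
  · exact key c hij hik hi
  · rw [natCast_mem_solubleSet_not_iff]
    exact key (fun x => (!(c x).1, (c x).2)) (by simp only [hij]) (by simp only [hik])
      (by simp only [hi, Bool.not_true])

/-! ### Densities as finite sums over classes. -/

theorem Fintype.sum_pi_fin_succ {C M : Type*} [Fintype C] [AddCommMonoid M] {n : ℕ}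
    (F : (Fin (n + 1) → C) → M) : ∑ f, F f = ∑ a, ∑ g : Fin n → C, F (Fin.cons a g) := by
  rw [← Fintype.sum_prod_type' fun a g => F (Fin.cons a g)]
  exact (Fintype.sum_equiv (Fin.consEquiv fun _ => C) _ _ fun _ => rfl).symm

/-- If the units of `ℤ_p` are partitioned into sets `B u` and the valuation parities and unit
classes of its coefficients determine whether a diagonal form is isotropic, then the local density
is a finite sum over tuples of classes. -/
theorem localDensity_eq_sum_classes {p : ℕ} [Fact p.Prime] {U : Type*} [Fintype U] {n k : ℕ}
    (B : U → Set ℤ_[p]) (hB : ∀ u, MeasurableSet (B u)) (hunit : ∀ u, ∀ x ∈ B u, IsUnit x)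
    (hdisj : ∀ u v, u ≠ v → Disjoint (B u) (B v)) (hcover : ∀ x, IsUnit x → ∃ u, x ∈ B u)
    {β : ℝ} (hβ : ∀ u, (padicHaar p).real (B u) = β)
    (P : (Fin (n + 1) → Bool × U) → Prop) [DecidablePred P]
    (hP : ∀ a c, (∀ i, a i ∈ parityClass p (c i).1 (B (c i).2)) → (a ∈ solubleSet p n k ↔ P c)) :
    localDensity p n k = ∑ c : Fin (n + 1) → Bool × U with P c,
      ∏ i, ((p : ℝ)⁻¹ ^ (c i).1.toNat * (β / (1 - ((p : ℝ) ^ 2)⁻¹))) := by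
  rw [localDensity, measureReal_pi_eq_sum_classes (padicHaar p)
    (fun c : Bool × U => parityClass p c.1 (B c.2)) (fun c => measurableSet_parityClass _ (hB _))
    ?_ ?_ _ P hP]
  · refine Finset.sum_congr rfl fun c _ => Finset.prod_congr rfl fun i _ => ?_
    rw [padicHaar_real_parityClass _ (hB _) (hunit _), hβ]
  · rintro ⟨e, u⟩ ⟨e', v⟩ h
    refine disjoint_parityClass (hunit _) (hunit _) ?_
    by_cases he : e = e'
    · exact Or.inr (hdisj _ _ fun huv => h (Prod.ext he huv))
    · exact Or.inl he
  · have h0 : ∀ᵐ x ∂padicHaar p, x ≠ 0 := by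
      rw [ae_iff]
      simpa using padicHaar_singleton_zero p
    filter_upwards [h0] with x hx
    obtain ⟨e, k, u, hu, rfl⟩ := PadicInt.exists_mem_parityClass hx
    obtain ⟨s, hs⟩ := hcover u hu
    exact ⟨(e, s), mem_parityClass.2 ⟨k, u, hs, rfl⟩⟩

/-- A class of parity `e` has measure `2⁻ᵉ (1/8) / (1 - 1/4) = 2^(1-e) / 12`; clearing the
denominator `12` in each coordinate leaves a sum of natural numbers. -/
theorem localDensity_two_eq {n : ℕ} :
    localDensity 2 n 2 = (∑ c : Fin (n + 1) → Bool × Fin 4,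
      if hasZeroModSixteen (List.ofFn fun i => dyadicRep (c i)) 0 false = true then
        ∏ i, 2 ^ (!(c i).1).toNat else 0 : ℕ) / 12 ^ (n + 1) := by
  rw [localDensity_eq_sum_classes dyadicUnits (fun r => (padicHaar_dyadicUnits r).1)
    (fun _ _ => isUnit_of_mem_dyadicUnits) (fun _ _ => disjoint_dyadicUnits)
    (fun _ => exists_mem_dyadicUnits) (fun r => (padicHaar_dyadicUnits r).2) _
    (fun _ _ => mem_solubleSet_iff_hasZeroModSixteen), ← Finset.sum_filter, Nat.cast_sum,
    Finset.sum_div]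
  refine Finset.sum_congr rfl fun c _ => ?_
  have h12 : (12 : ℝ) ^ (n + 1) = ∏ _i : Fin (n + 1), (12 : ℝ) := by simp
  rw [Nat.cast_prod, h12, ← Finset.prod_div_distrib]
  refine Finset.prod_congr rfl fun i _ => ?_
  cases (c i).1 <;> norm_num

set_option maxRecDepth 100000 in
theorem sum_hasZeroModSixteen_three :
    (∑ c : Fin 3 → Bool × Fin 4,
      if hasZeroModSixteen (List.ofFn fun i => dyadicRep (c i)) 0 false = true then
        ∏ i, 2 ^ (!(c i).1).toNat else 0) = 1008 := by
  simp only [Fintype.sum_pi_fin_succ]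
  decide +kernel

set_option maxRecDepth 100000 in
theorem sum_hasZeroModSixteen_four :
    (∑ c : Fin 4 → Bool × Fin 4,
      if hasZeroModSixteen (List.ofFn fun i => dyadicRep (c i)) 0 false = true then
        ∏ i, 2 ^ (!(c i).1).toNat else 0) = 19696 := by
  simp only [Fintype.sum_pi_fin_succ]
  decide +kernel

/-- Both quadratic characters have equal measure, so the weight of a tuple depends only on the
number `k` of odd valuations. -/
theorem localDensity_odd_eq {p : ℕ} [Fact p.Prime] (hp : p ≠ 2) {ε : Bool}
    (hε : quadraticChar (ZMod p) (-1) = boolSign ε) {n : ℕ} :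
    localDensity p n 2 = (((p : ℝ) - 1) / 2 * (p : ℝ)⁻¹ / (1 - ((p : ℝ) ^ 2)⁻¹)) ^ (n + 1) *
      ∑ k ∈ Finset.range (n + 2), (Finset.univ.filter fun c : Fin (n + 1) → Bool × Bool =>
        IsotropicClasses ε c ∧ ∑ i, (c i).1.toNat = k).card * (p : ℝ)⁻¹ ^ k := by
  rw [localDensity_eq_sum_classes (quadraticUnits p) (fun s => (padicHaar_quadraticUnits hp s).1)
    (fun _ _ => isUnit_of_mem_quadraticUnits) (fun _ _ => disjoint_quadraticUnits)
    (fun _ => exists_mem_quadraticUnits) (fun s => (padicHaar_quadraticUnits hp s).2) _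
    (fun _ _ => mem_solubleSet_iff_isotropicClasses hp hε)]
  have hmaps : ∀ c ∈ Finset.univ.filter fun c : Fin (n + 1) → Bool × Bool => IsotropicClasses ε c,
      ∑ i, (c i).1.toNat ∈ Finset.range (n + 2) := by
    intro c _
    have : ∑ i, (c i).1.toNat ≤ ∑ _i : Fin (n + 1), 1 :=
      Finset.sum_le_sum fun i _ => Bool.toNat_le _
    rw [Finset.mem_range]
    simp only [Finset.sum_const, Finset.card_univ, Fintype.card_fin, smul_eq_mul, mul_one] at this
    omega
  rw [← Finset.sum_fiberwise_of_maps_to hmaps, Finset.mul_sum]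
  refine Finset.sum_congr rfl fun k _ => ?_
  rw [Finset.filter_filter, Finset.sum_congr rfl (g := fun _ =>
    (((p : ℝ) - 1) / 2 * (p : ℝ)⁻¹ / (1 - ((p : ℝ) ^ 2)⁻¹)) ^ (n + 1) * (p : ℝ)⁻¹ ^ k)]
  · rw [Finset.sum_const, nsmul_eq_mul]
    ring
  · intro c hc
    rw [← (Finset.mem_filter.1 hc).2.2, Finset.prod_mul_distrib, Finset.prod_pow_eq_pow_sum]
    rw [Finset.prod_const, Finset.card_univ, Fintype.card_fin, mul_comm]

/-- If all parities agree, all `8` sign choices are isotropic. Otherwise there are `3` positions for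
the odd one out, and half of the sign choices make the remaining pair isotropic. -/
theorem card_isotropicClasses_three (ε : Bool) : ∀ k : Fin 4,
    (Finset.univ.filter fun c : Fin 3 → Bool × Bool =>
      IsotropicClasses ε c ∧ ∑ i, (c i).1.toNat = k).card = ![8, 12, 12, 8] k := by
  revert ε
  decide +kernel

/-- Only the split `2 + 2` can be anisotropic: among its `6` arrangements, a quarter of the `16`
sign choices make both pairs anisotropic, leaving `6 · 12 = 72`. -/
theorem card_isotropicClasses_four (ε : Bool) : ∀ k : Fin 5,
    (Finset.univ.filter fun c : Fin 4 → Bool × Bool =>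
      IsotropicClasses ε c ∧ ∑ i, (c i).1.toNat = k).card = ![16, 64, 72, 64, 16] k := by
  revert ε
  decide +kernel

theorem exists_quadraticChar_neg_one_eq (p : ℕ) [Fact p.Prime] :
    ∃ ε, quadraticChar (ZMod p) (-1) = boolSign ε := by
  rcases quadraticChar_dichotomy (F := ZMod p) (a := -1) (by simp) with h | h
  · exact ⟨true, h⟩
  · exact ⟨false, h⟩

theorem localDensity_two_of_ne_two {p : ℕ} [Fact p.Prime] (hp : p ≠ 2) :
    localDensity p 2 2
      = 1 - 3 / 2 * (p : ℝ)⁻¹ * ((1 - (p : ℝ)⁻¹) / (1 - ((p : ℝ) ^ 2)⁻¹)) ^ 2 := by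
  obtain ⟨ε, hε⟩ := exists_quadraticChar_neg_one_eq p
  have hp1 : (1 : ℝ) < p := by exact_mod_cast (Fact.out : p.Prime).one_lt
  have hsub : (p : ℝ) - 1 ≠ 0 := by linarith
  have hadd : (p : ℝ) + 1 ≠ 0 := by linarith
  have hq : 1 - ((p : ℝ) ^ 2)⁻¹ = (p - 1) * (p + 1) / p ^ 2 := by field_simp; ring
  have hc := card_isotropicClasses_three ε
  rw [localDensity_odd_eq hp hε]
  simp only [Finset.sum_range_succ, Finset.sum_range_zero, zero_add]
  have h0 := hc 0
  have h1 := hc 1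
  have h2 := hc 2
  have h3 := hc 3
  simp only [Fin.coe_ofNat_eq_mod, Nat.reduceMod, Nat.zero_mod, Matrix.cons_val] at h0 h1 h2 h3
  simp only [Nat.reduceAdd, h0, h1, h2, h3, hq]
  push_cast
  field_simp
  ring

theorem localDensity_three_of_ne_two {p : ℕ} [Fact p.Prime] (hp : p ≠ 2) :
    localDensity p 3 2
      = 1 - 3 / 2 * ((p : ℝ) ^ 2)⁻¹ * ((1 - (p : ℝ)⁻¹) / (1 - ((p : ℝ) ^ 2)⁻¹)) ^ 4 := by
  obtain ⟨ε, hε⟩ := exists_quadraticChar_neg_one_eq p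
  have hp1 : (1 : ℝ) < p := by exact_mod_cast (Fact.out : p.Prime).one_lt
  have hsub : (p : ℝ) - 1 ≠ 0 := by linarith
  have hadd : (p : ℝ) + 1 ≠ 0 := by linarith
  have hq : 1 - ((p : ℝ) ^ 2)⁻¹ = (p - 1) * (p + 1) / p ^ 2 := by field_simp; ring
  have hc := card_isotropicClasses_four ε
  rw [localDensity_odd_eq hp hε]
  simp only [Finset.sum_range_succ, Finset.sum_range_zero, zero_add]
  have h0 := hc 0
  have h1 := hc 1
  have h2 := hc 2
  have h3 := hc 3
  have h4 := hc 4
  simp only [Fin.coe_ofNat_eq_mod, Nat.reduceMod, Nat.zero_mod, Matrix.cons_val] at h0 h1 h2 h3 h4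
  simp only [Nat.reduceAdd, h0, h1, h2, h3, h4, hq]
  push_cast
  field_simp
  ring

/-! ### Five or more variables, and the conclusion. -/

/-- Every diagonal quadratic form in at least five variables over `ℤ_p` is isotropic. -/
theorem solubleSet_eq_univ {p : ℕ} [Fact p.Prime] {n : ℕ} (hn : 4 ≤ n) :
    solubleSet p n 2 = Set.univ := by
  refine Set.eq_univ_of_forall fun a => ?_
  by_cases h0 : ∃ i, a i = 0
  · obtain ⟨i, hi⟩ := h0
    exact mem_solubleSet_of_eq_zero two_ne_zero hi
  push Not at h0
  refine mem_solubleSet_of_comp (m := 4) two_ne_zero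
    (Fin.castLE_injective (show 4 + 1 ≤ n + 1 by omega)) ?_
  choose e k u hu hau using fun i : Fin 5 =>
    PadicInt.exists_mem_parityClass (h0 (Fin.castLE (show 4 + 1 ≤ n + 1 by omega) i))
  by_cases hp : p = 2
  · subst hp
    choose r hr using fun i => exists_mem_dyadicUnits (hu i)
    refine (mem_solubleSet_iff_hasZeroModSixteen (c := fun i => (e i, r i))
      fun i => mem_parityClass.2 ⟨k i, u i, hr i, hau i⟩).2 ?_
    rw [← natCast_mem_solubleSet_iff fun i => rfl]
    exact natCast_mem_solubleSet_four _
  · obtain ⟨ε, hε⟩ := exists_quadraticChar_neg_one_eq p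
    choose s hs using fun i => exists_mem_quadraticUnits (hu i)
    refine (mem_solubleSet_iff_isotropicClasses hp hε (c := fun i => (e i, s i))
      fun i => mem_parityClass.2 ⟨k i, u i, hs i, hau i⟩).2 ?_
    -- Five coefficients and two parities: some parity occurs more than twice.
    exact Or.inr (Fintype.exists_lt_card_fiber_of_mul_lt_card e (by simp))

theorem theorem1p3 (p : ℕ) [Fact p.Prime] :
    (localDensity p 2 2 =
      if p = 2 then 7 / 12
      else 1 - 3 / 2 * (p : ℝ)⁻¹ * ((1 - (p : ℝ)⁻¹) / (1 - ((p : ℝ) ^ 2)⁻¹)) ^ 2) ∧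
    (localDensity p 3 2 =
      if p = 2 then 1231 / 1296
      else 1 - 3 / 2 * ((p : ℝ) ^ 2)⁻¹ * ((1 - (p : ℝ)⁻¹) / (1 - ((p : ℝ) ^ 2)⁻¹)) ^ 4) ∧
    (∀ n : ℕ, 4 ≤ n → localDensity p n 2 = 1) := by
  refine ⟨?_, ?_, fun n hn => ?_⟩
  · split_ifs with hp
    · subst hp
      rw [localDensity_two_eq, sum_hasZeroModSixteen_three]
      norm_num
    · exact localDensity_two_of_ne_two hp
  · split_ifs with hp
    · subst hp
      rw [localDensity_two_eq, sum_hasZeroModSixteen_four]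
      norm_num
    · exact localDensity_three_of_ne_two hp
  · rw [localDensity, solubleSet_eq_univ hn]
    exact probReal_univ
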